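/- Let $L/K$ be a finite Galois extension of fields with Galois group $\Gamma=\mathrm{Gal}(L/K)$. A Hopf-Galois structure on $L/K$ consists of a $K$-Hopf algebra $H$, with comultiplication $\Delta(h)=\sum_{(h)}h_{(1)}\otimes h_{(2)}$ and counit $\epsilon$, together with a $K$-linear action of $H$ on $L$ making $L$ an $H$-module such that $h\cdot(xy)=\sum_{(h)}(h_{(1)}\cdot x)(h_{(2)}\cdot y)$ and $h\cdot k=\epsilon(h)k$ for all $h\in H$, $x,y\in L$, $k\in K$, and such that the $K$-linear map $\theta\colon L\otimes_K L\to \mathrm{Hom}_K(H,L)$, $\theta(x\otimes y)(h)=x(h\cdot y)$, is bijective. It is said to be of type $G$, for a group $G$, if $L\otimes_K H\cong L[G]$ as $L$-Hopf algebras. Suppose that $L/K$ admits a Hopf-Galois structure of type $G$. If $G$ is nilpotent, then $\Gamma$ is soluble. Thus, if a finite Galois extension of fields admits a Hopf-Galois structure of nilpotent type, then the extension has soluble Galois group. -/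

import Mathlib

open scoped TensorProduct

noncomputable section

/-- For a `K`-algebra `H` acting `K`-linearly on `L`, the canonical map
`θ : L ⊗[K] L → Hom_K(H, L)`, `θ (x ⊗ y) h = x * (h · y)`. -/
def hopfGaloisMap {K L H : Type*} [Field K] [Field L] [Algebra K L] [Ring H] [Algebra K H]
    (act : H →ₐ[K] Module.End K L) : L ⊗[K] L →ₗ[K] (H →ₗ[K] L) :=
  TensorProduct.lift <|
    LinearMap.mk₂ K (fun x y => LinearMap.mulLeft K x ∘ₗ act.toLinearMap.flip y)
      (fun x x' y => by ext h; simp [add_mul])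
      (fun c x y => by ext h; simp)
      (fun x y y' => by ext h; simp [mul_add])
      (fun c x y => by ext h; simp)

/-- A Hopf-Galois structure on the field extension `L/K` with acting `K`-Hopf algebra `H`:
an action of `H` making `L` an `H`-module algebra, for which the canonical map
`L ⊗[K] L → Hom_K(H, L)` is bijective. -/
structure HopfGaloisStructure (K L H : Type*) [Field K] [Field L] [Algebra K L]
    [Ring H] [HopfAlgebra K H] where
  /-- The (unital, associative, `K`-linear) action `h · x = act h x`. -/
  act : H →ₐ[K] Module.End K L
  /-- `h · (x * y) = ∑ (h₁ · x) * (h₂ · y)`, where `Δ h = ∑ h₁ ⊗ h₂`. -/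
  act_mul : ∀ (h : H) (x y : L),
    act h (x * y) = LinearMap.mul' K L
      (TensorProduct.map (act.toLinearMap.flip x) (act.toLinearMap.flip y)
        (Coalgebra.comul (R := K) h))
  /-- `h · k = ε(h) k` for `k ∈ K`. -/
  act_algebraMap : ∀ (h : H) (k : K),
    act h (algebraMap K L k) = Coalgebra.counit (R := K) h • algebraMap K L k
  bijective : Function.Bijective (hopfGaloisMap act)

/-- A Hopf-Galois structure on `L/K` with acting Hopf algebra `H` has type `G` if `H` becomes,
after base change to `L`, the group algebra of `G` as an `L`-Hopf algebra: `L ⊗[K] H ≅ L[G]`.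
(An isomorphism of bialgebras between Hopf algebras commutes with the antipodes.) For a finite
Galois extension this says that `H` is the fixed Hopf algebra `L[N]^Gal(L/K)` of a regular
permutation group `N ≅ G`. -/
def HopfGaloisStructure.HasType {K L H : Type*} [Field K] [Field L] [Algebra K L]
    [Ring H] [HopfAlgebra K H] (_S : HopfGaloisStructure K L H) (G : Type*) [Group G] : Prop :=
  Nonempty ((L ⊗[K] H) ≃ₐc[L] MonoidAlgebra L G)

end

/-!
Under `L ⊗[K] H ≅ L[G]` the elements of `G` become group-like elements of `L ⊗[K] H`, so they act on
`L` by automorphisms over `K`; bijectivity of `θ` makes the resulting map `γ : G → Gal(L/K)` a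
bijection. It need not be a homomorphism, because the scalars `L` do not commute with the action,
but `γ g * γ h = γ (g * φ h)` for an automorphism `φ` of `G` depending on `g`. Hence `γ` carries
characteristic subgroups of `G` to subgroups of `Gal(L/K)` of the same order. If `G` is nilpotent,
then for each prime `p` the product of its Sylow subgroups for the other primes is a characteristic
`p`-complement, so `Gal(L/K)` has a `p`-complement for every `p` and is soluble by Hall's theorem.

Hall's theorem follows by induction from Wielandt's theorem on three soluble subgroups of pairwise
coprime index, starting from Burnside's `p ^ a * q ^ b` theorem. The character theory in the latter
needs only the semisimplicity of `ℂ[G]` and the trace of its regular representation.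
-/

/-! ### Averages of roots of unity -/

theorem eq_of_forall_norm_le_of_sum_eq_card_nsmul {E : Type*} [NormedAddCommGroup E]
    [InnerProductSpace ℝ E] {s : Multiset E} {a : E} (hs : ∀ z ∈ s, ‖z‖ ≤ ‖a‖)
    (hsum : s.sum = s.card • a) {z : E} (hz : z ∈ s) : z = a := by
  have hle : ∀ w ∈ s, ‖w - a‖ ^ 2 ≤ 2 * inner ℝ a (a - w) := fun w hw => by
    have := pow_le_pow_left₀ (norm_nonneg w) (hs w hw) 2
    rw [norm_sub_sq_real, inner_sub_right, real_inner_self_eq_norm_sq, real_inner_comm]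
    linarith
  have hzero : (s.map fun w => 2 * inner ℝ a (a - w)).sum = 0 := by
    have := map_multiset_sum (innerₛₗ ℝ a) (s.map (a - ·))
    rw [Multiset.sum_map_sub, Multiset.map_const', Multiset.sum_replicate, Multiset.map_id', hsum,
      sub_self, map_zero, Multiset.map_map] at this
    rw [Multiset.sum_map_mul_left]
    exact mul_eq_zero_of_right 2 this.symm
  have hnorm : (s.map fun w => ‖w - a‖ ^ 2).sum ≤ 0 := hzero ▸ Multiset.sum_map_le_sum_map _ _ hle
  have hmem := Multiset.single_le_sum (Multiset.forall_mem_map_iff.2 fun w _ => sq_nonneg ‖w - a‖) _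
    (Multiset.mem_map_of_mem _ hz)
  simpa [sub_eq_zero] using hmem.trans hnorm

theorem eq_of_isIntegral_average_of_numberField {F : Type*} [Field F] [NumberField F] {n : ℕ}
    (hn : n ≠ 0) {s : Multiset F} (hs : ∀ z ∈ s, z ^ n = 1) {a : F} (hsum : s.sum = s.card * a)
    (ha : IsIntegral ℤ a) (ha0 : a ≠ 0) {z : F} (hz : z ∈ s) : z = a := by
  have hnorm (φ : F →+* ℂ) {w : F} (hw : w ^ n = 1) : ‖φ w‖ = 1 :=
    Complex.norm_eq_one_of_pow_eq_one (by rw [← map_pow, hw, map_one]) hn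
  have hcard : 0 < (s.card : ℝ) := Nat.cast_pos.2 (Multiset.card_pos_iff_exists_mem.2 ⟨z, hz⟩)
  have hle (φ : F →+* ℂ) : ‖φ a‖ ≤ 1 := by
    refine le_of_mul_le_mul_left ?_ hcard
    calc (s.card : ℝ) * ‖φ a‖ = ‖(s.map φ).sum‖ := by
          rw [← map_multiset_sum, hsum, map_mul, map_natCast, norm_mul, Complex.norm_natCast]
      _ ≤ ((s.map φ).map norm).sum := norm_multiset_sum_le _
      _ ≤ s.card * 1 := by
          simpa using Multiset.sum_le_card_nsmul ((s.map φ).map norm) 1 (by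
            simpa using fun w hw => (hnorm φ (hs w hw)).le)
  obtain ⟨m, hm, ham⟩ := NumberField.Embeddings.pow_eq_one_of_norm_le_one F ℂ ha0 ha hle
  let φ : F →+* ℂ := Classical.arbitrary _
  have haφ : ‖φ a‖ = 1 :=
    Complex.norm_eq_one_of_pow_eq_one (by rw [← map_pow, ham, map_one]) hm.ne'
  refine φ.injective (eq_of_forall_norm_le_of_sum_eq_card_nsmul (s := s.map φ) ?_ ?_
    (Multiset.mem_map_of_mem φ hz))
  · exact Multiset.forall_mem_map_iff.2 fun w hw => by rw [hnorm φ (hs w hw), haφ]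
  · rw [← map_multiset_sum, hsum, Multiset.card_map, nsmul_eq_mul, map_mul, map_natCast]

theorem eq_of_isIntegral_average {k : Type*} [Field k] [CharZero k] {n : ℕ} (hn : n ≠ 0)
    {s : Multiset k} (hs : ∀ z ∈ s, z ^ n = 1) {a : k} (hsum : s.sum = s.card * a)
    (ha : IsIntegral ℤ a) (ha0 : a ≠ 0) {z : k} (hz : z ∈ s) : z = a := by
  let F := IntermediateField.adjoin ℚ {w : k | w ∈ s}
  have : Finite {w : k | w ∈ s} := Multiset.finite_toSet s
  have : FiniteDimensional ℚ F := IntermediateField.finiteDimensional_adjoin fun w hw =>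
    .of_pow (Nat.pos_of_ne_zero hn) (hs w hw ▸ isIntegral_one)
  have : NumberField F := {}
  have hsF : ∀ w ∈ s, w ∈ F := fun w hw => IntermediateField.subset_adjoin ℚ _ hw
  have haF : a ∈ F := by
    have hcard : (s.card : k) ≠ 0 :=
      Nat.cast_ne_zero.2 (Multiset.card_pos_iff_exists_mem.2 ⟨z, hz⟩).ne'
    rw [← mul_div_cancel_left₀ a hcard, ← hsum]
    exact div_mem (multiset_sum_mem s hsF) (natCast_mem F _)
  clear_value F
  lift s to Multiset F using hsF
  lift a to F using haF
  obtain ⟨w, hw, rfl⟩ := Multiset.mem_map.1 hz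
  refine congrArg _ (eq_of_isIntegral_average_of_numberField hn (s := s) (a := a)
    (fun z hz => ?_) ?_ ?_ ?_ hw)
  · exact_mod_cast hs z (Multiset.mem_map_of_mem _ hz)
  · refine Subtype.coe_injective ?_
    simpa using hsum
  · exact (isIntegral_algebraMap_iff (algebraMap F k).injective).1 ha
  · exact_mod_cast ha0

open Polynomial in
theorem eq_algebraMap_of_squarefree_of_isNilpotent_sub {k B : Type*} [Field k] [Ring B]
    [Algebra k B] {x : B} {a : k} {f : k[X]} (hf : Squarefree f) (hfx : aeval x f = 0)
    (hx : IsNilpotent (x - algebraMap k B a)) : x = algebraMap k B a := by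
  obtain ⟨m, hm⟩ := hx
  have hdvd : minpoly k x ∣ (X - C a) ^ (m + 1) := minpoly.dvd k x (by simp [pow_succ, hm])
  have hsq : Squarefree (minpoly k x) := hf.squarefree_of_dvd (minpoly.dvd k x hfx)
  obtain ⟨q, hq⟩ := (hsq.dvd_pow_iff_dvd m.succ_ne_zero).1 hdvd
  have : aeval x (X - C a) = 0 := by rw [hq, map_mul, minpoly.aeval, zero_mul]
  simpa [sub_eq_zero] using this

section Matrix

variable {k ι : Type*} [Field k] [Fintype ι] [DecidableEq ι] {A : Matrix ι ι k} {n : ℕ}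

theorem pow_eq_one_of_mem_roots_charpoly (hA : A ^ n = 1) {z : k} (hz : z ∈ A.charpoly.roots) :
    z ^ n = 1 := by
  have hzA : z ∈ spectrum k A :=
    Matrix.mem_spectrum_iff_isRoot_charpoly.2 (Polynomial.isRoot_of_mem_roots hz)
  cases isEmpty_or_nonempty ι
  · simp at hz
  · simpa [hA] using spectrum.pow_mem_pow A n hzA

variable [IsAlgClosed k]

theorem isIntegral_trace_of_pow_eq_one (hn : n ≠ 0) (hA : A ^ n = 1) : IsIntegral ℤ A.trace := by
  rw [Matrix.trace_eq_sum_roots_charpoly]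
  exact .multiset_sum fun z hz => .of_pow (Nat.pos_of_ne_zero hn)
    (pow_eq_one_of_mem_roots_charpoly hA hz ▸ isIntegral_one)

open Polynomial in
theorem eq_algebraMap_of_trace_eq_card_mul [CharZero k] (hn : n ≠ 0) (hA : A ^ n = 1)
    {a : k} (htr : A.trace = Fintype.card ι * a) (ha : IsIntegral ℤ a) (ha0 : a ≠ 0) :
    A = algebraMap k _ a := by
  have hsplits : A.charpoly.Splits := IsAlgClosed.splits A.charpoly
  have hcard : A.charpoly.roots.card = Fintype.card ι := by
    rw [← hsplits.natDegree_eq_card_roots, Matrix.charpoly_natDegree_eq_dim]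
  have hroots : A.charpoly.roots = Multiset.replicate (Fintype.card ι) a :=
    Multiset.eq_replicate.2 ⟨hcard, fun z hz => eq_of_isIntegral_average hn
      (fun w hw => pow_eq_one_of_mem_roots_charpoly hA hw)
      (by rw [← Matrix.trace_eq_sum_roots_charpoly, htr, hcard]) ha ha0 hz⟩
  have hchar : A.charpoly = (X - C a) ^ Fintype.card ι := by
    rw [hsplits.eq_prod_roots_of_monic A.charpoly_monic, hroots]
    simp
  have hsq : Squarefree (X ^ n - 1 : k[X]) :=
    (X_pow_sub_one_separable_iff.2 (Nat.cast_ne_zero.2 hn)).squarefree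
  refine eq_algebraMap_of_squarefree_of_isNilpotent_sub hsq (by simp [hA]) ⟨Fintype.card ι, ?_⟩
  simpa [hchar] using Matrix.aeval_self_charpoly A

end Matrix

/-! ### The trace of the regular representation -/

section RegularTrace

variable {R : Type*} [CommRing R]

theorem trace_eq_sum_repr {M ι : Type*} [AddCommGroup M] [Module R M] [Fintype ι]
    (b : Module.Basis ι R M) (f : M →ₗ[R] M) :
    LinearMap.trace R M f = ∑ i, b.repr (f (b i)) i := by
  classical
  simp only [LinearMap.trace_eq_matrix_trace R b, Matrix.trace, Matrix.diag_apply,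
    LinearMap.toMatrix_apply]

theorem trace_mulLeft_pi {ι : Type*} [Fintype ι] {B : ι → Type*} [∀ i, Ring (B i)]
    [∀ i, Algebra R (B i)] [∀ i, Module.Free R (B i)] [∀ i, Module.Finite R (B i)]
    (x : ∀ i, B i) :
    LinearMap.trace R _ (LinearMap.mulLeft R x) =
      ∑ i, LinearMap.trace R _ (LinearMap.mulLeft R (x i)) := by
  classical
  let b (i : ι) := Module.Free.chooseBasis R (B i)
  simp [trace_eq_sum_repr (Pi.basis b), fun i => trace_eq_sum_repr (b i), Fintype.sum_sigma]

theorem trace_mulLeft_matrix {ι : Type*} [Fintype ι] (A : Matrix ι ι R) :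
    LinearMap.trace R _ (LinearMap.mulLeft R A) = Fintype.card ι * A.trace := by
  classical
  have hrepr (B : Matrix ι ι R) (x : ι × ι) : (Matrix.stdBasis R ι ι).repr B x = B x.1 x.2 := rfl
  simp [trace_eq_sum_repr (Matrix.stdBasis R ι ι), hrepr, Fintype.sum_prod_type,
    Matrix.stdBasis_eq_single, Matrix.trace, Finset.mul_sum]

open scoped Classical in
theorem trace_mulLeft_single {G : Type*} [Group G] [Finite G] (g : G) :
    LinearMap.trace R _ (LinearMap.mulLeft R (MonoidAlgebra.single g (1 : R))) =
      if g = 1 then (Nat.card G : R) else 0 := by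
  have := Fintype.ofFinite G
  let b : Module.Basis G R (MonoidAlgebra R G) := .ofRepr (MonoidAlgebra.coeffLinearEquiv R)
  have hb (x : G) : b x = .single x 1 := rfl
  have hrepr (x : G) : b.repr (.single g 1 * b x) x = if g = 1 then 1 else 0 := by
    rw [hb, MonoidAlgebra.single_mul_single, mul_one, ← hb, Module.Basis.repr_self,
      Finsupp.single_apply, mul_eq_right]
  simp [trace_eq_sum_repr b, hrepr]

end RegularTrace

open scoped Classical in
theorem exists_surjective_algHom_matrix (k G : Type*) [Field k] [IsAlgClosed k] [CharZero k]
    [Group G] [Finite G] :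
    ∃ (n : ℕ) (d : Fin n → ℕ)
      (f : ∀ i, MonoidAlgebra k G →ₐ[k] Matrix (Fin (d i)) (Fin (d i)) k),
      (∀ i, Function.Surjective (f i)) ∧
      ∀ g, ∑ i, (d i : k) * (f i (.of k G g)).trace = if g = 1 then (Nat.card G : k) else 0 := by
  have : NeZero (Nat.card G : k) := ⟨Nat.cast_ne_zero.2 Nat.card_pos.ne'⟩
  obtain ⟨n, d, -, ⟨e⟩⟩ :=
    IsSemisimpleRing.exists_algEquiv_pi_matrix_of_isAlgClosed k (MonoidAlgebra k G)
  refine ⟨n, d, fun i => (Pi.evalAlgHom k _ i).comp e.toAlgHom,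
    fun i => (Function.surjective_eval i).comp e.surjective, fun g => ?_⟩
  have hconj : e.toLinearEquiv.conj (LinearMap.mulLeft k (.of k G g)) =
      LinearMap.mulLeft k (e (.of k G g)) := by
    ext1 x
    simp
  calc ∑ i, (d i : k) * (e (.of k G g) i).trace
      = LinearMap.trace k _ (LinearMap.mulLeft k (e (.of k G g))) := by
        simp_rw [trace_mulLeft_pi, trace_mulLeft_matrix, Fintype.card_fin]
    _ = _ := by rw [← hconj, LinearMap.trace_conj', MonoidAlgebra.of_apply, trace_mulLeft_single]

/-! ### Burnside's theorems -/

section ClassSum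

open MonoidAlgebra (of)

variable {R G : Type*} [CommRing R] [Group G]

theorem ncard_conjugatesOf (g : G) :
    (conjugatesOf g).ncard = (Subgroup.centralizer {g}).index := by
  have horbit : conjugatesOf g = MulAction.orbit (ConjAct G) g := by
    ext x
    rw [ConjAct.mem_orbit_conjAct, isConj_comm, conjugatesOf, Set.mem_ofPred_eq]
  rw [horbit, ← MulAction.index_stabilizer, ConjAct.stabilizer_eq_centralizer]
  rfl

theorem mem_center_of_forall_of_mul_comm {x : MonoidAlgebra R G}
    (hx : ∀ g, of R G g * x = x * of R G g) : x ∈ Subalgebra.center R (MonoidAlgebra R G) := by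
  refine Subalgebra.mem_center_iff.2 fun y => ?_
  induction y using MonoidAlgebra.induction_on with
  | of g => exact hx g
  | add y z hy hz => rw [add_mul, mul_add, hy, hz]
  | smul c y hy => rw [smul_mul_assoc, mul_smul_comm, hy]

theorem exists_map_eq_algebraMap {A B : Type*} [Ring A] [Ring B] [Algebra R A] [Algebra R B]
    [Algebra.IsCentral R B] {f : A →ₐ[R] B} (hf : Function.Surjective f) {x : A}
    (hx : x ∈ Subalgebra.center R A) : ∃ c, f x = algebraMap R B c := by
  refine (Algebra.IsCentral.mem_center_iff R).1 (Subalgebra.mem_center_iff.2 fun y => ?_)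
  obtain ⟨y, rfl⟩ := hf y
  rw [← map_mul, ← map_mul, Subalgebra.mem_center_iff.1 hx]

variable [Finite G]

variable (R) in
/-- The class sum of `g`: the sum of the conjugates of `g`, as an element of the group algebra. -/
noncomputable def classSum (g : G) : MonoidAlgebra R G :=
  ∑ x ∈ (conjugatesOf g).toFinite.toFinset, of R G x

theorem classSum_mem_center (g : G) :
    classSum R g ∈ Subalgebra.center R (MonoidAlgebra R G) := by
  refine mem_center_of_forall_of_mul_comm fun h => ?_
  rw [classSum, Finset.mul_sum, Finset.sum_mul]
  refine Finset.sum_equiv (MulAut.conj h).toEquiv (fun x => ?_) fun x _ => by simp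
  have hx : IsConj x (MulAut.conj h x) := isConj_iff.2 ⟨h, rfl⟩
  simpa using ⟨fun hgx => hgx.trans hx, fun hgx => hgx.trans hx.symm⟩

theorem isIntegral_classSum (g : G) : IsIntegral ℤ (classSum R g) := by
  have : IsIntegral ℤ (classSum ℤ g) := .of_finite ℤ _
  simpa [classSum] using this.map (MonoidAlgebra.lift ℤ _ G (of R G))

theorem trace_map_classSum {ι : Type*} [Fintype ι] [DecidableEq ι]
    (f : MonoidAlgebra R G →ₐ[R] Matrix ι ι R) (g : G) :
    (f (classSum R g)).trace = (Subgroup.centralizer {g}).index * (f (of R G g)).trace := by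
  have hconj : ∀ x ∈ (conjugatesOf g).toFinite.toFinset,
      (f (of R G x)).trace = (f (of R G g)).trace := by
    intro x hx
    have hgx : x ∈ conjugatesOf g := (Set.Finite.mem_toFinset _).1 hx
    obtain ⟨h, rfl⟩ := isConj_iff.1 hgx
    rw [map_mul, map_mul, Matrix.trace_mul_comm, ← map_mul, ← map_mul, inv_mul_cancel_left]
  rw [classSum, map_sum, Matrix.trace_sum, Finset.sum_congr rfl hconj, Finset.sum_const,
    nsmul_eq_mul, ← Set.ncard_eq_toFinset_card, ncard_conjugatesOf]

end ClassSum

theorem dvd_of_mul_eq_intCast {k : Type*} [Field k] [CharZero k] {p m : ℤ} {b : k}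
    (hb : IsIntegral ℤ b) (h : p * b = m) : p ∣ m := by
  rcases eq_or_ne p 0 with rfl | hp
  · exact zero_dvd_iff.2 (Int.cast_eq_zero.1 (by rw [← h, Int.cast_zero, zero_mul]))
  have hbq : b = algebraMap ℚ k (m / p) := by
    rw [map_div₀, map_intCast, map_intCast, ← h, mul_div_cancel_left₀ _ (Int.cast_ne_zero.2 hp)]
  rw [hbq, isIntegral_algebraMap_iff (algebraMap ℚ k).injective] at hb
  obtain ⟨n, hn⟩ := IsIntegrallyClosed.isIntegral_iff.1 hb
  rw [eq_intCast, eq_div_iff (Int.cast_ne_zero.2 hp), mul_comm] at hn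
  exact ⟨n, by exact_mod_cast hn.symm⟩

section Burnside

open MonoidAlgebra (of)

variable {k G : Type*} [Field k] [Group G] {ι : Type*} [Fintype ι] [DecidableEq ι]
  {f : MonoidAlgebra k G →ₐ[k] Matrix ι ι k}

theorem map_of_pow_card (f : MonoidAlgebra k G →ₐ[k] Matrix ι ι k) (g : G) :
    f (of k G g) ^ Nat.card G = 1 := by
  rw [← map_pow, ← map_pow, pow_card_eq_one', map_one, map_one]

theorem map_sum_of_eq_zero [Fintype G] (hf : Function.Surjective f) {g : G}
    (hg : f (of k G g) ≠ 1) : f (∑ x, of k G x) = 0 := by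
  have hleft (h : G) : of k G h * ∑ x, of k G x = ∑ x, of k G x := by
    rw [Finset.mul_sum]
    exact Fintype.sum_equiv (Equiv.mulLeft h) _ _ fun x => (map_mul _ _ _).symm
  have hright (h : G) : (∑ x, of k G x) * of k G h = ∑ x, of k G x := by
    rw [Finset.sum_mul]
    exact Fintype.sum_equiv (Equiv.mulRight h) _ _ fun x => (map_mul _ _ _).symm
  obtain ⟨c, hc⟩ := exists_map_eq_algebraMap hf
    (mem_center_of_forall_of_mul_comm fun h => (hleft h).trans (hright h).symm)
  have hgc : c • (f (of k G g) - 1) = 0 := by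
    have := congrArg f (hright g)
    rw [map_mul, hc, ← Algebra.smul_def, Algebra.algebraMap_eq_smul_one] at this
    rw [smul_sub, this, sub_self]
  rw [hc, (smul_eq_zero.1 hgc).resolve_right (sub_ne_zero.2 hg), map_zero]

open scoped Classical in
theorem sum_sq_of_forall_map_eq_one [CharZero k] [Finite G] {κ : Type*} [Fintype κ] {d : κ → ℕ}
    {f : ∀ i, MonoidAlgebra k G →ₐ[k] Matrix (Fin (d i)) (Fin (d i)) k}
    (hf : ∀ i, Function.Surjective (f i))
    (hreg : ∀ g, ∑ i, (d i : k) * (f i (of k G g)).trace = if g = 1 then (Nat.card G : k) else 0) :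
    ∑ i with ∀ x, f i (of k G x) = 1, (d i : k) ^ 2 = 1 := by
  have := Fintype.ofFinite G
  have hsum (i : κ) : (f i (∑ x, of k G x)).trace =
      if ∀ x, f i (of k G x) = 1 then (Nat.card G : k) * d i else 0 := by
    split_ifs with hi
    · rw [map_sum, Matrix.trace_sum, Finset.sum_congr rfl fun x _ => by
        rw [hi x, Matrix.trace_one, Fintype.card_fin], Finset.sum_const, Finset.card_univ,
        nsmul_eq_mul, Nat.card_eq_fintype_card]
    · obtain ⟨x, hx⟩ := not_forall.1 hi
      rw [map_sum_of_eq_zero (hf i) hx, Matrix.trace_zero]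
  refine mul_left_cancel₀ (Nat.cast_ne_zero.2 Nat.card_pos.ne' : (Nat.card G : k) ≠ 0) ?_
  calc _ = ∑ i, (d i : k) * (f i (∑ x, of k G x)).trace := by
        simp_rw [hsum, Finset.mul_sum, Finset.sum_filter]
        refine Finset.sum_congr rfl fun i _ => ?_
        split_ifs <;> ring
    _ = ∑ x, ∑ i, (d i : k) * (f i (of k G x)).trace := by
        simp_rw [map_sum, Matrix.trace_sum, Finset.mul_sum]
        exact Finset.sum_comm
    _ = Nat.card G * 1 := by simp_rw [hreg, Fintype.sum_ite_eq', mul_one]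

variable [IsAlgClosed k] [CharZero k] [Finite G]

theorem trace_eq_zero_or_eq_algebraMap_of_coprime (hf : Function.Surjective f) {g : G}
    (hg : (Subgroup.centralizer {g}).index.Coprime (Fintype.card ι)) :
    (f (of k G g)).trace = 0 ∨ ∃ c, f (of k G g) = algebraMap k _ c := by
  cases isEmpty_or_nonempty ι
  · exact .inr ⟨0, Subsingleton.elim _ _⟩
  set χ := (f (of k G g)).trace
  obtain ⟨ω, hω⟩ := exists_map_eq_algebraMap hf (classSum_mem_center g)
  have hωint : IsIntegral ℤ ω := by
    rw [← isIntegral_algebraMap_iff (FaithfulSMul.algebraMap_injective k (Matrix ι ι k)), ← hω]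
    exact (isIntegral_classSum g).map (f.restrictScalars ℤ)
  have hχint : IsIntegral ℤ χ :=
    isIntegral_trace_of_pow_eq_one Nat.card_pos.ne' (map_of_pow_card f g)
  have hωχ : Fintype.card ι * ω = (Subgroup.centralizer {g}).index * χ := by
    rw [← trace_map_classSum, hω, Matrix.algebraMap_eq_diagonal, Matrix.trace_diagonal]
    simp
  obtain ⟨u, v, huv⟩ := Nat.isCoprime_iff_coprime.2 hg
  have huv' : (u * (Subgroup.centralizer {g}).index + v * Fintype.card ι : k) = 1 := by
    exact_mod_cast congrArg (Int.cast : ℤ → k) huv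
  have hχd : χ = Fintype.card ι * (u * ω + v * χ) := by
    linear_combination (-u : k) * hωχ - χ * huv'
  refine or_iff_not_imp_left.2 fun hχ0 => ⟨u * ω + v * χ, ?_⟩
  refine eq_algebraMap_of_trace_eq_card_mul Nat.card_pos.ne' (map_of_pow_card f g) hχd ?_ ?_
  · simpa using ((isIntegral_algebraMap (x := u)).mul hωint).add
      ((isIntegral_algebraMap (x := v)).mul hχint)
  · exact fun h => hχ0 (by rw [hχd, h, mul_zero])

theorem exists_isIntegral_card_mul_trace_eq_mul [IsSimpleGroup G] (hf : Function.Surjective f)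
    {x : G} (hx : f (of k G x) ≠ 1) {g : G} (hg : g ∉ Subgroup.center G) {p : ℕ} (hp : p.Prime)
    {m : ℕ} (hgp : (Subgroup.centralizer {g}).index = p ^ m) :
    ∃ a, IsIntegral ℤ a ∧ Fintype.card ι * (f (of k G g)).trace = p * a := by
  by_cases hpd : p ∣ Fintype.card ι
  · obtain ⟨d, hd⟩ := hpd
    exact ⟨d * (f (of k G g)).trace, (isIntegral_natCast d).mul
      (isIntegral_trace_of_pow_eq_one Nat.card_pos.ne' (map_of_pow_card f g)),
      by rw [hd, Nat.cast_mul, mul_assoc]⟩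
  have hcop : (Subgroup.centralizer {g}).index.Coprime (Fintype.card ι) :=
    hgp ▸ Nat.Coprime.pow_left m (hp.coprime_iff_not_dvd.2 hpd)
  obtain htr | ⟨c, hc⟩ := trace_eq_zero_or_eq_algebraMap_of_coprime hf hcop
  · exact ⟨0, isIntegral_zero, by rw [htr, mul_zero, mul_zero]⟩
  let ρ : G →* Matrix ι ι k := (f : MonoidAlgebra k G →* Matrix ι ι k).comp (of k G)
  have hinj : Function.Injective ρ := (MonoidHom.ker_eq_bot_iff ρ).1 <|
    (Subgroup.Normal.eq_bot_or_eq_top inferInstance).resolve_right fun h =>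
      hx (DFunLike.congr_fun (MonoidHom.ker_eq_top_iff.1 h) x)
  refine absurd (Subgroup.mem_center_iff.2 fun h => hinj ?_) hg
  rw [map_mul, map_mul, show ρ g = _ from hc, Algebra.commutes]

theorem mem_center_of_index_centralizer_eq_prime_pow {G : Type*} [Group G] [Finite G]
    [IsSimpleGroup G] {g : G} {p : ℕ} (hp : p.Prime) {m : ℕ}
    (hgp : (Subgroup.centralizer {g}).index = p ^ m) : g ∈ Subgroup.center G := by
  classical
  by_contra hg
  obtain ⟨n, d, f, hf, hreg⟩ := exists_surjective_algHom_matrix ℂ G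
  let T : Finset (Fin n) := {i | ∀ x, f i (of ℂ G x) = 1}
  have htriv : ∑ i ∈ T, (d i : ℂ) * (f i (of ℂ G g)).trace = 1 := by
    rw [← sum_sq_of_forall_map_eq_one hf hreg]
    refine Finset.sum_congr rfl fun i hi => ?_
    rw [(Finset.mem_filter_univ i).1 hi g, Matrix.trace_one, Fintype.card_fin, sq]
  have hnontriv (i) (hi : i ∈ Tᶜ) :
      ∃ a, IsIntegral ℤ a ∧ (d i : ℂ) * (f i (of ℂ G g)).trace = p * a := by
    obtain ⟨x, hx⟩ : ∃ x, f i (of ℂ G x) ≠ 1 := by simpa [T] using hi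
    simpa using exists_isIntegral_card_mul_trace_eq_mul (hf i) hx hg hp hgp
  choose! a ha hga using hnontriv
  have hg1 : g ≠ 1 := fun h => hg (h ▸ Subgroup.one_mem _)
  have hsum : 1 + p * ∑ i ∈ Tᶜ, a i = 0 := by
    rw [Finset.mul_sum, ← Finset.sum_congr rfl hga, ← htriv, Finset.sum_add_sum_compl, hreg,
      if_neg hg1]
  have hdvd : (p : ℤ) ∣ -1 := dvd_of_mul_eq_intCast (.sum _ ha) (by
    push_cast
    linear_combination hsum)
  exact hp.ne_one (Nat.dvd_one.1 (by exact_mod_cast Int.dvd_neg.1 hdvd))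

end Burnside

theorem isSolvable_of_forall_isSimpleGroup.{u} {P : ℕ → Prop} (hP : ∀ m n, m ∣ n → P n → P m)
    (hsimple : ∀ (S : Type u) [Group S] [Finite S] [IsSimpleGroup S],
      P (Nat.card S) → Group.IsSolvable S)
    {G : Type u} [Group G] [Finite G] (hG : P (Nat.card G)) : Group.IsSolvable G := by
  induction hn : Nat.card G using Nat.strong_induction_on generalizing G with
  | _ n ih =>
  subst hn
  cases subsingleton_or_nontrivial G
  · infer_instance
  by_cases hs : IsSimpleGroup G
  · exact hsimple G hG
  obtain ⟨N, hN, hN0, hN1⟩ : ∃ N : Subgroup G, N.Normal ∧ N ≠ ⊥ ∧ N ≠ ⊤ := by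
    by_contra! h
    exact hs ⟨fun N hN => or_iff_not_imp_left.2 (h N hN)⟩
  refine (Group.isSolvable_iff_subgroup_quotient N).2
    ⟨ih _ ?_ (hP _ _ N.card_subgroup_dvd_card hG) rfl, ih _ ?_ (hP _ _ ?_ hG) rfl⟩
  · rw [← N.card_mul_index]
    exact lt_mul_of_one_lt_right Nat.card_pos (N.one_lt_index_of_ne_top hN1)
  · rw [← N.index_eq_card, ← N.index_mul_card]
    exact lt_mul_of_one_lt_right (Nat.pos_of_ne_zero N.index_ne_zero_of_finite)
      (N.one_lt_card_iff_ne_bot.2 hN0)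
  · exact N.index_eq_card ▸ N.index_dvd_card

theorem exists_eq_prime_pow_of_card_primeFactors_le_one {n : ℕ} (hn : n ≠ 0)
    (h : n.primeFactors.card ≤ 1) : ∃ p m, p.Prime ∧ n = p ^ m := by
  obtain h | h := Nat.le_one_iff_eq_zero_or_eq_one.1 h
  · have := (Nat.primeFactors_eq_empty.1 (Finset.card_eq_zero.1 h)).resolve_left hn
    exact ⟨2, 0, Nat.prime_two, by rw [this, pow_zero]⟩
  · obtain ⟨p, m, hp, -, rfl⟩ :=
      (isPrimePow_nat_iff _).1 (isPrimePow_iff_card_primeFactors_eq_one.2 h)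
    exact ⟨p, m, hp, rfl⟩

theorem card_primeFactors_le_of_not_dvd {m n p k : ℕ} (hp : p.Prime) (hpn : p ∣ n) (hn : n ≠ 0)
    (hmn : m ∣ n) (hpm : ¬ p ∣ m) (hk : n.primeFactors.card ≤ k + 1) :
    m.primeFactors.card ≤ k := by
  have hlt : m.primeFactors ⊂ n.primeFactors := by
    refine (Finset.ssubset_iff_of_subset (Nat.primeFactors_mono hmn hn)).2
      ⟨p, Nat.mem_primeFactors.2 ⟨hp, hpn, hn⟩, fun h => hpm (Nat.dvd_of_mem_primeFactors h)⟩
  exact Nat.lt_succ_iff.1 ((Finset.card_lt_card hlt).trans_le hk)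

theorem exists_ne_one_not_dvd_index_centralizer {G : Type*} [Group G] [Finite G] {q : ℕ}
    (hq : q.Prime) (hqG : q ∣ Nat.card G) :
    ∃ g : G, g ≠ 1 ∧ ¬ q ∣ (Subgroup.centralizer {g}).index := by
  have : Fact q.Prime := ⟨hq⟩
  let Q : Sylow q G := default
  have : Nontrivial Q := (Subgroup.nontrivial_iff_ne_bot _).2 (Q.ne_bot_of_dvd_card hqG)
  have := Q.isPGroup'.center_nontrivial
  obtain ⟨z, hz⟩ := exists_ne (1 : Subgroup.center Q)
  refine ⟨z, fun h => hz (Subtype.ext (Subtype.ext h)), fun h =>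
    Q.not_dvd_index (h.trans (Subgroup.index_dvd_of_le fun x hx => ?_))⟩
  rw [Subgroup.mem_centralizer_singleton_iff]
  exact congrArg Subtype.val (Subgroup.mem_center_iff.1 z.2 ⟨x, hx⟩)

theorem isSolvable_of_card_primeFactors_le_two {G : Type*} [Group G] [Finite G]
    (hG : (Nat.card G).primeFactors.card ≤ 2) : Group.IsSolvable G := by
  refine isSolvable_of_forall_isSimpleGroup (P := fun n => n ≠ 0 ∧ n.primeFactors.card ≤ 2)
    (fun m n hmn h => ⟨ne_zero_of_dvd_ne_zero h.1 hmn,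
      (Finset.card_le_card (Nat.primeFactors_mono hmn h.1)).trans h.2⟩)
    (fun S _ _ _ hS => ?_) ⟨Nat.card_pos.ne', hG⟩
  obtain ⟨q, hq, hqS⟩ := Nat.exists_prime_and_dvd (Finite.one_lt_card (α := S)).ne'
  obtain ⟨g, hg1, hqg⟩ := exists_ne_one_not_dvd_index_centralizer hq hqS
  obtain ⟨p, m, hp, hgp⟩ := exists_eq_prime_pow_of_card_primeFactors_le_one
    Subgroup.index_ne_zero_of_finite
    (card_primeFactors_le_of_not_dvd hq hqS hS.1 (Subgroup.index_dvd_card _) hqg hS.2)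
  have hg : g ∈ Subgroup.center S := mem_center_of_index_centralizer_eq_prime_pow hp hgp
  have htop : Subgroup.center S = ⊤ :=
    (Subgroup.Normal.eq_bot_or_eq_top inferInstance).resolve_left fun h =>
      hg1 (Subgroup.mem_bot.1 (h ▸ hg))
  exact Group.isSolvable_of_comm fun x y =>
    Subgroup.mem_center_iff.1 (htop ▸ Subgroup.mem_top y) x

/-! ### The theorems of Wielandt and Hall -/

section CoprimeIndex

variable {G : Type*} [Group G]

theorem relIndex_eq_index_of_coprime {H K : Subgroup G} [H.FiniteIndex]
    (h : H.index.Coprime K.index) :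
    H.relIndex K = H.index := by
  have : H.IsFiniteRelIndex K := Subgroup.isFiniteRelIndex_of_finiteIndex
  have hmul : H.relIndex K * K.index = (H ⊓ K).relIndex H * H.index := by
    rw [Subgroup.relIndex_mul_index inf_le_left, ← Subgroup.inf_relIndex_right,
      Subgroup.relIndex_mul_index inf_le_right]
  have hle : H.relIndex K ≤ H.index := Subgroup.relIndex_top_right H ▸
    Subgroup.relIndex_le_of_le_right le_top (by
      simpa using Subgroup.FiniteIndex.index_ne_zero)
  exact hle.antisymm (Nat.le_of_dvd (Nat.pos_of_ne_zero Subgroup.relIndex_ne_zero)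
    (h.dvd_of_dvd_mul_right (Dvd.intro_left _ hmul.symm)))

theorem exists_mul_eq_of_coprime_index {H K : Subgroup G} [H.FiniteIndex]
    (h : H.index.Coprime K.index) (x : G) : ∃ a ∈ K, ∃ b ∈ H, a * b = x := by
  have hstab : MulAction.stabilizer K ((1 : G) : G ⧸ H) = H.subgroupOf K := by
    ext a
    rw [MulAction.mem_stabilizer_iff, eq_comm]
    exact QuotientGroup.eq.trans (by simp [Subgroup.mem_subgroupOf])
  have horbit : MulAction.orbit K ((1 : G) : G ⧸ H) = Set.univ := by
    refine Set.eq_of_subset_of_ncard_le (Set.subset_univ _) ?_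
    rw [← MulAction.index_stabilizer, hstab, Set.ncard_univ, ← Subgroup.index_eq_card]
    exact (relIndex_eq_index_of_coprime h).ge
  obtain ⟨a, ha⟩ : (x : G ⧸ H) ∈ MulAction.orbit K ((1 : G) : G ⧸ H) := horbit ▸ Set.mem_univ _
  refine ⟨a, a.2, a⁻¹ * x, ?_, mul_inv_cancel_left _ x⟩
  simpa using QuotientGroup.eq.1 ha

theorem le_of_isPGroup_of_not_dvd_index {p : ℕ} [Fact p.Prime] {N K : Subgroup G}
    [hN : N.Normal] (hp : IsPGroup p N) (hK : ¬ p ∣ K.index) : N ≤ K := by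
  obtain ⟨⟨x⟩, hx⟩ := hp.nonempty_fixed_point_of_prime_not_dvd_card (G ⧸ K) hK
  intro n hn
  have := QuotientGroup.eq.1 (hx ⟨_, hN.conj_mem n hn x⟩)
  simpa [mul_assoc] using this

theorem exists_normal_isPGroup [Finite G] [Group.IsSolvable G] [Nontrivial G] :
    ∃ p : ℕ, p.Prime ∧ ∃ N : Subgroup G, N.Normal ∧ N ≠ ⊥ ∧ IsPGroup p N := by
  obtain ⟨A, ⟨hA, hA0⟩, hmin⟩ := exists_minimal_of_wellFoundedLT
    (fun A : Subgroup G => A.Normal ∧ A ≠ ⊥) ⟨⊤, inferInstance, top_ne_bot⟩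
  have hcomm : ⁅A, A⁆ = ⊥ := by
    by_contra h
    have hlt := Group.IsSolvable.commutator_lt_of_ne_bot hA0
    exact hlt.not_ge (hmin ⟨inferInstance, h⟩ hlt.le)
  have : IsMulCommutative A := Subgroup.commutator_self_eq_bot_iff.1 hcomm
  obtain ⟨p, hp, hpA⟩ := Nat.exists_prime_and_dvd (mt Subgroup.card_eq_one.1 hA0)
  have : Fact p.Prime := ⟨hp⟩
  let P : Sylow p A := default
  have := P.characteristic_of_normal inferInstance
  refine ⟨p, hp, (P : Subgroup A).map A.subtype, inferInstance, fun h => ?_, P.2.map _⟩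
  exact P.ne_bot_of_dvd_card hpA
    ((Subgroup.map_eq_bot_iff_of_injective _ A.subtype_injective).1 h)

theorem normalClosure_le_of_coprime_index {H K N : Subgroup G} [H.FiniteIndex]
    (h : H.index.Coprime K.index) (hN : ∀ x ∈ H, ∀ n ∈ N, x * n * x⁻¹ ∈ N) (hNK : N ≤ K) :
    Subgroup.normalClosure (N : Set G) ≤ K := by
  rw [Subgroup.normalClosure, Subgroup.closure_le]
  intro y hy
  obtain ⟨n, hn, hny⟩ := Group.mem_conjugatesOfSet_iff.1 hy
  obtain ⟨x, rfl⟩ := isConj_iff.1 hny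
  obtain ⟨a, ha, b, hb, rfl⟩ := exists_mul_eq_of_coprime_index h x
  have := K.mul_mem (K.mul_mem ha (hNK (hN b hb n hn))) (K.inv_mem ha)
  simpa [mul_assoc] using this

theorem exists_normal_le_or_le [Finite G] {H₁ H₂ H₃ : Subgroup G} [Group.IsSolvable H₁]
    [Nontrivial H₁] (h₁₂ : H₁.index.Coprime H₂.index) (h₁₃ : H₁.index.Coprime H₃.index)
    (h₂₃ : H₂.index.Coprime H₃.index) :
    ∃ M : Subgroup G, M.Normal ∧ M ≠ ⊥ ∧ (M ≤ H₂ ∨ M ≤ H₃) := by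
  obtain ⟨p, hp, N, hN, hN0, hpN⟩ := exists_normal_isPGroup (G := H₁)
  have : Fact p.Prime := ⟨hp⟩
  have hconj : ∀ x ∈ H₁, ∀ n ∈ N.map H₁.subtype, x * n * x⁻¹ ∈ N.map H₁.subtype := by
    rintro x hx _ ⟨n, hn, rfl⟩
    exact ⟨⟨x, hx⟩ * n * ⟨x, hx⟩⁻¹, hN.conj_mem n hn _, rfl⟩
  have hle {K : Subgroup G} (h : H₁.index.Coprime K.index) (hpK : ¬ p ∣ K.index) :
      Subgroup.normalClosure (N.map H₁.subtype : Set G) ≤ K := by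
    refine normalClosure_le_of_coprime_index h hconj (Subgroup.map_le_iff_le_comap.2 ?_)
    rw [← relIndex_eq_index_of_coprime h.symm] at hpK
    exact le_of_isPGroup_of_not_dvd_index hpN hpK
  refine ⟨Subgroup.normalClosure (N.map H₁.subtype : Set G), inferInstance, fun h => hN0 ?_, ?_⟩
  · exact (Subgroup.map_eq_bot_iff_of_injective _ H₁.subtype_injective).1
      (le_bot_iff.1 (h ▸ Subgroup.le_normalClosure))
  · exact or_iff_not_imp_left.2 fun h₂ => hle h₁₃ fun hp₃ =>
      Nat.not_coprime_of_dvd_of_dvd hp.one_lt (not_imp_comm.1 (hle h₁₂) h₂) hp₃ h₂₃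

end CoprimeIndex

theorem isSolvable_of_coprime_index {G : Type*} [Group G] [Finite G] {H₁ H₂ H₃ : Subgroup G}
    (hs₁ : Group.IsSolvable H₁) (hs₂ : Group.IsSolvable H₂) (hs₃ : Group.IsSolvable H₃)
    (h₁₂ : H₁.index.Coprime H₂.index) (h₁₃ : H₁.index.Coprime H₃.index)
    (h₂₃ : H₂.index.Coprime H₃.index) : Group.IsSolvable G := by
  induction hn : Nat.card G using Nat.strong_induction_on generalizing G with
  | _ n ih =>
  subst hn
  cases subsingleton_or_nontrivial H₁
  · have : H₂ = ⊤ := by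
      rw [H₁.eq_bot_of_subsingleton, Subgroup.index_bot] at h₁₂
      exact Subgroup.index_eq_one.1 (h₁₂.symm.eq_one_of_dvd H₂.index_dvd_card)
    subst this
    exact Group.isSolvable_of_surjective (f := (⊤ : Subgroup G).subtype)
      fun x => ⟨⟨x, trivial⟩, rfl⟩
  obtain ⟨M, hM, hM0, hle⟩ := exists_normal_le_or_le h₁₂ h₁₃ h₂₃
  have hMs : Group.IsSolvable M := hle.elim
    (fun h => Group.isSolvable_of_isSolvable_injective (Subgroup.inclusion_injective h))
    (fun h => Group.isSolvable_of_isSolvable_injective (Subgroup.inclusion_injective h))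
  have hcard : Nat.card (G ⧸ M) < Nat.card G := by
    rw [← M.index_eq_card, ← M.index_mul_card]
    exact lt_mul_of_one_lt_right (Nat.pos_of_ne_zero M.index_ne_zero_of_finite)
      (M.one_lt_card_iff_ne_bot.2 hM0)
  have hmap {H : Subgroup G} (hH : Group.IsSolvable H) :
      Group.IsSolvable (H.map (QuotientGroup.mk' M)) :=
    Group.isSolvable_of_surjective ((QuotientGroup.mk' M).subgroupMap_surjective H)
  have hdvd (H : Subgroup G) := H.index_map_dvd (QuotientGroup.mk'_surjective M)
  refine (Group.isSolvable_iff_subgroup_quotient M).2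
    ⟨hMs, ih _ hcard (hmap hs₁) (hmap hs₂) (hmap hs₃) ?_ ?_ ?_ rfl⟩
  exacts [.of_dvd (hdvd _) (hdvd _) h₁₂, .of_dvd (hdvd _) (hdvd _) h₁₃,
    .of_dvd (hdvd _) (hdvd _) h₂₃]

/-- `H` is a `p`-complement of `G`: its index is a power of `p` and its order is prime to `p`. -/
structure IsPComplement {G : Type*} [Group G] (p : ℕ) (H : Subgroup G) : Prop where
  index_eq_pow : ∃ k, H.index = p ^ k
  not_dvd_card : ¬ p ∣ Nat.card H

namespace IsPComplement

variable {G : Type*} [Group G] {p : ℕ} {H : Subgroup G}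

theorem top (h : ¬ p ∣ Nat.card G) : IsPComplement p (⊤ : Subgroup G) where
  index_eq_pow := ⟨0, by rw [Subgroup.index_top, pow_zero]⟩
  not_dvd_card := by rwa [Subgroup.card_top]

theorem coprime_index {q : ℕ} {K : Subgroup G} (hH : IsPComplement p H) (hK : IsPComplement q K)
    (hpq : p.Coprime q) : H.index.Coprime K.index := by
  obtain ⟨k, hk⟩ := hH.index_eq_pow
  obtain ⟨l, hl⟩ := hK.index_eq_pow
  exact hk ▸ hl ▸ hpq.pow k l

theorem card_lt [Finite G] (hH : IsPComplement p H) (hp : p ∣ Nat.card G) :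
    Nat.card H < Nat.card G :=
  (Nat.le_of_dvd Nat.card_pos H.card_subgroup_dvd_card).lt_of_ne fun h =>
    hH.not_dvd_card (h ▸ hp)

theorem subgroupOf [Finite G] {q : ℕ} {K : Subgroup G} (hH : IsPComplement p H)
    (hK : IsPComplement q K) (hpq : p.Coprime q) : IsPComplement p (H.subgroupOf K) where
  index_eq_pow := by
    obtain ⟨k, hk⟩ := hH.index_eq_pow
    exact ⟨k, (relIndex_eq_index_of_coprime (hH.coprime_index hK hpq)).trans hk⟩
  not_dvd_card h := hH.not_dvd_card <| h.trans <| by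
    rw [← Subgroup.card_map_of_injective K.subtype_injective, Subgroup.subgroupOf_map_subtype]
    exact Subgroup.card_dvd_of_le inf_le_left

end IsPComplement

theorem isSolvable_of_forall_exists_isPComplement {G : Type*} [Group G] [Finite G]
    (h : ∀ p : ℕ, p.Prime → ∃ H : Subgroup G, IsPComplement p H) : Group.IsSolvable G := by
  induction hn : Nat.card G using Nat.strong_induction_on generalizing G with
  | _ n ih =>
  subst hn
  by_cases h2 : (Nat.card G).primeFactors.card ≤ 2
  · exact isSolvable_of_card_primeFactors_le_two h2
  have hsolv {p : ℕ} (hp : p ∈ (Nat.card G).primeFactors) {H : Subgroup G}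
      (hH : IsPComplement p H) : Group.IsSolvable H := by
    refine ih _ (hH.card_lt (Nat.dvd_of_mem_primeFactors hp)) (fun r hr => ?_) rfl
    rcases eq_or_ne r p with rfl | hrp
    · exact ⟨⊤, .top hH.not_dvd_card⟩
    · obtain ⟨R, hR⟩ := h r hr
      exact ⟨_, hR.subgroupOf hH
        ((Nat.coprime_primes hr (Nat.prime_of_mem_primeFactors hp)).2 hrp)⟩
  obtain ⟨p, q, r, hp, hq, hr, hpq, hpr, hqr⟩ := Finset.two_lt_card_iff.1 (not_le.1 h2)
  have hp' := Nat.prime_of_mem_primeFactors hp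
  have hq' := Nat.prime_of_mem_primeFactors hq
  have hr' := Nat.prime_of_mem_primeFactors hr
  obtain ⟨P, hP⟩ := h p hp'
  obtain ⟨Q, hQ⟩ := h q hq'
  obtain ⟨R, hR⟩ := h r hr'
  exact isSolvable_of_coprime_index (hsolv hp hP) (hsolv hq hQ) (hsolv hr hR)
    (hP.coprime_index hQ ((Nat.coprime_primes hp' hq').2 hpq))
    (hP.coprime_index hR ((Nat.coprime_primes hp' hr').2 hpr))
    (hQ.coprime_index hR ((Nat.coprime_primes hq' hr').2 hqr))

/-! ### Twisted homomorphisms from nilpotent groups -/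

theorem le_of_coprime_card_index {G : Type*} [Group G] {H N : Subgroup G} [N.Normal]
    (h : (Nat.card H).Coprime N.index) : H ≤ N :=
  Subgroup.relIndex_eq_one.1 <| Nat.eq_one_of_dvd_coprimes h (N.relIndex_dvd_card H)
    (N.relIndex_dvd_index_of_normal H)

theorem characteristic_of_coprime_card_index {G : Type*} [Group G] {N : Subgroup G} [N.Normal]
    (h : (Nat.card N).Coprime N.index) : N.Characteristic :=
  Subgroup.characteristic_iff_map_le.2 fun φ => le_of_coprime_card_index <| by
    rwa [Subgroup.card_map_of_injective φ.injective]

theorem exists_characteristic_isPComplement {G : Type*} [Group G] [Finite G]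
    [Group.IsNilpotent G] {p : ℕ} (hp : p.Prime) :
    ∃ M : Subgroup G, M.Characteristic ∧ IsPComplement p M := by
  by_cases hpG : p ∣ Nat.card G
  swap
  · exact ⟨⊤, inferInstance, .top hpG⟩
  have : Fact p.Prime := ⟨hp⟩
  let e := Sylow.directProductOfNormal (G := G) fun {q hq} P => inferInstance
  let P : Sylow p G := default
  let π := (Pi.evalMonoidHom _ P).comp <| Pi.evalMonoidHom
    (fun q : (Nat.card G).primeFactors => ∀ P : Sylow q G, P)
    ⟨p, Nat.mem_primeFactors.2 ⟨hp, hpG, Nat.card_pos.ne'⟩⟩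
  have hπ : Function.Surjective π :=
    (Function.surjective_eval P).comp (Function.surjective_eval _)
  let f : G →* P := π.comp e.symm.toMonoidHom
  have hf : Function.Surjective f := hπ.comp e.symm.surjective
  have hindex : f.ker.index = Nat.card P := by
    rw [Subgroup.index_ker, MonoidHom.range_eq_top.2 hf, Subgroup.card_top]
  have hcard : Nat.card f.ker = P.index := by
    refine Nat.eq_of_mul_eq_mul_right (Nat.card_pos (α := P)) ?_
    rw [← hindex, Subgroup.card_mul_index, hindex, Subgroup.index_mul_card]
  refine ⟨f.ker, characteristic_of_coprime_card_index ?_, ?_, ?_⟩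
  · rw [hcard, hindex]
    exact P.card_coprime_index.symm
  · exact hindex ▸ IsPGroup.iff_card.1 P.isPGroup'
  · exact hcard ▸ P.not_dvd_index

/-- A map of groups that is multiplicative up to automorphisms of its domain. A bijective
`γ : G → Γ` of this kind is the same thing as a regular embedding of `Γ` into the holomorph of
`G`. -/
def IsTwistedHom {G Γ : Type*} [Group G] [Group Γ] (γ : G → Γ) : Prop :=
  ∀ g, ∃ φ : G ≃* G, ∀ h, γ g * γ h = γ (g * φ h)

namespace IsTwistedHom

variable {G Γ : Type*} [Group G] [Group Γ] {γ : G → Γ}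

theorem map_one (hγ : IsTwistedHom γ) : γ 1 = 1 := by
  obtain ⟨φ, hφ⟩ := hγ 1
  simpa using hφ 1

/-- The image of a characteristic subgroup under a twisted homomorphism, as a subgroup. -/
def mapSubgroup (hγ : IsTwistedHom γ) (M : Subgroup G) [hM : M.Characteristic] : Subgroup Γ where
  carrier := γ '' M
  one_mem' := ⟨1, M.one_mem, hγ.map_one⟩
  mul_mem' := by
    rintro _ _ ⟨g, hg, rfl⟩ ⟨h, hh, rfl⟩
    obtain ⟨φ, hφ⟩ := hγ g
    exact ⟨g * φ h, M.mul_mem hg (Subgroup.characteristic_iff_le_comap.1 hM φ hh), (hφ h).symm⟩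
  inv_mem' := by
    rintro _ ⟨g, hg, rfl⟩
    obtain ⟨φ, hφ⟩ := hγ g
    refine ⟨φ.symm g⁻¹, Subgroup.characteristic_iff_le_comap.1 hM φ.symm (M.inv_mem hg), ?_⟩
    rw [← mul_eq_one_iff_eq_inv', hφ, φ.apply_symm_apply, mul_inv_cancel, hγ.map_one]

variable (hγ : IsTwistedHom γ) (M : Subgroup G) [M.Characteristic]

theorem card_mapSubgroup (hinj : Function.Injective γ) :
    Nat.card (hγ.mapSubgroup M) = Nat.card M :=
  Nat.card_image_of_injective hinj M

theorem index_mapSubgroup [Finite G] (hbij : Function.Bijective γ) :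
    (hγ.mapSubgroup M).index = M.index := by
  refine Nat.eq_of_mul_eq_mul_left (Nat.card_pos (α := M)) ?_
  rw [M.card_mul_index, Nat.card_congr (Equiv.ofBijective γ hbij),
    ← (hγ.mapSubgroup M).card_mul_index, card_mapSubgroup hγ M hbij.1]

theorem isSolvable (hγ : IsTwistedHom γ) [Finite G] [Group.IsNilpotent G]
    (hbij : Function.Bijective γ) : Group.IsSolvable Γ := by
  have : Finite Γ := .of_surjective γ hbij.2
  refine isSolvable_of_forall_exists_isPComplement fun p hp => ?_
  obtain ⟨M, hM, hMp⟩ := exists_characteristic_isPComplement (G := G) hp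
  exact ⟨hγ.mapSubgroup M, by simpa only [index_mapSubgroup hγ M hbij] using hMp.index_eq_pow,
    by simpa only [card_mapSubgroup hγ M hbij.1] using hMp.not_dvd_card⟩

end IsTwistedHom

/-! ### Hopf-Galois structures -/

namespace HopfGaloisStructure

variable {K L H : Type*} [Field K] [Field L] [Algebra K L] [Ring H] [HopfAlgebra K H]
  (S : HopfGaloisStructure K L H)

/-- The map `z ↦ z · y`, where `L ⊗[K] H` acts on `L` by `(a ⊗ h) · y = a * (h · y)`. This is not
a module structure: `L` is central in `L ⊗[K] H`, but its multiplications on `L` do not commute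
with the action of `H`. -/
noncomputable def orbitMap : L →ₗ[K] L ⊗[K] H →ₗ[L] L :=
  (LinearMap.liftBaseChange L S.act.toLinearMap).flip

@[simp]
theorem orbitMap_tmul (y a : L) (h : H) : S.orbitMap y (a ⊗ₜ h) = a * S.act h y := by
  simp [orbitMap]

theorem orbitMap_mul (x y : L) (z : L ⊗[K] H) :
    S.orbitMap (x * y) z = LinearMap.mul' L L
      (TensorProduct.map (S.orbitMap x) (S.orbitMap y) (Coalgebra.comul (R := L) z)) := by
  induction z with
  | zero => simp only [map_zero]
  | add z w hz hw => simp only [map_add, hz, hw]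
  | tmul a h =>
    rw [orbitMap_tmul, act_mul, TensorProduct.comul_tmul]
    induction Coalgebra.comul (R := K) h with
    | zero => simp
    | add u v hu hv => simp only [map_add, mul_add, hu, hv, TensorProduct.tmul_add]
    | tmul u v => simp [mul_left_comm]

theorem orbitMap_one (z : L ⊗[K] H) : S.orbitMap 1 z = Coalgebra.counit (R := L) z := by
  induction z with
  | zero => simp only [map_zero]
  | add z w hz hw => simp only [map_add, hz, hw]
  | tmul a h =>
    have := S.act_algebraMap h 1
    rw [map_one] at this
    simp [this, Algebra.smul_def, mul_comm]

theorem liftBaseChange_hopfGaloisMap_tmul (x y : L) :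
    LinearMap.liftBaseChange L (hopfGaloisMap S.act (x ⊗ₜ y)) = x • S.orbitMap y := by
  ext h
  simp [hopfGaloisMap]

/-- Every `L`-linear form on `L ⊗[K] H` comes from a `K`-linear map `H → L`, hence is an `L`-linear
combination of orbit maps because `θ` is surjective. -/
theorem eq_zero_of_orbitMap_eq_zero {z : L ⊗[K] H} (hz : ∀ y, S.orbitMap y z = 0) : z = 0 := by
  refine (Module.forall_dual_apply_eq_zero_iff L z).1 fun φ => ?_
  obtain ⟨f, rfl⟩ := (LinearMap.liftBaseChangeEquiv L).surjective φ
  obtain ⟨t, rfl⟩ := S.bijective.2 f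
  induction t with
  | zero => simp only [map_zero, LinearMap.zero_apply]
  | add t u ht hu => simp only [map_add, LinearMap.add_apply, ht, hu, add_zero]
  | tmul x y =>
    have := S.liftBaseChange_hopfGaloisMap_tmul x y
    exact (DFunLike.congr_fun this z).trans (by rw [LinearMap.smul_apply, hz, smul_zero])

theorem eq_of_orbitMap_eq {z w : L ⊗[K] H} (h : ∀ y, S.orbitMap y z = S.orbitMap y w) : z = w :=
  sub_eq_zero.1 <| S.eq_zero_of_orbitMap_eq_zero fun y => by rw [map_sub, h, sub_self]

/-- The endomorphism of `L/K` by which a group-like element of `L ⊗[K] H` acts. -/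
noncomputable def groupLikeHom {z : L ⊗[K] H} (hz : IsGroupLikeElem L z) : L →ₐ[K] L :=
  AlgHom.ofLinearMap (S.orbitMap.flip z) ((S.orbitMap_one z).trans hz.counit_eq_one) fun x y => by
    simp [orbitMap_mul, hz.comul_eq_tmul_self]

@[simp]
theorem groupLikeHom_apply {z : L ⊗[K] H} (hz : IsGroupLikeElem L z) (y : L) :
    S.groupLikeHom hz y = S.orbitMap y z :=
  rfl

theorem orbitMap_act (y : L) (h : H) (z : L ⊗[K] H) :
    S.orbitMap (S.act h y) z = S.orbitMap y (z * 1 ⊗ₜ h) := by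
  induction z with
  | zero => simp
  | add z w hz hw => simp only [map_add, hz, hw, add_mul]
  | tmul a k => simp

theorem orbitMap_orbitMap {z : L ⊗[K] H} (hz : IsGroupLikeElem L z) (w : L ⊗[K] H) (y : L) :
    S.orbitMap (S.orbitMap y w) z =
      S.orbitMap y (z * Algebra.TensorProduct.map (S.groupLikeHom hz) (AlgHom.id K H) w) := by
  induction w with
  | zero => simp
  | add u v hu hv => simp only [map_add, mul_add, ← hu, ← hv, LinearMap.add_apply]
  | tmul a h =>
    have hsmul : S.groupLikeHom hz a ⊗ₜ[K] h = S.groupLikeHom hz a • (1 : L) ⊗ₜ[K] h := by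
      rw [TensorProduct.smul_tmul', smul_eq_mul, mul_one]
    calc S.orbitMap (S.orbitMap y (a ⊗ₜ h)) z
        = S.groupLikeHom hz (a * S.act h y) := by rw [orbitMap_tmul, groupLikeHom_apply]
      _ = S.groupLikeHom hz a * S.orbitMap (S.act h y) z := map_mul _ _ _
      _ = S.orbitMap y (z * S.groupLikeHom hz a ⊗ₜ h) := by
        rw [hsmul, mul_smul_comm, map_smul, smul_eq_mul, orbitMap_act]

/-- The `σ`-semilinear automorphism `a ⊗ h ↦ σ a ⊗ h` of the ring `L ⊗[K] H`. -/
noncomputable def twist (H : Type*) [Ring H] [Algebra K H] (σ : Gal(L/K)) :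
    (L ⊗[K] H) ≃ₐ[K] L ⊗[K] H :=
  Algebra.TensorProduct.congr σ AlgEquiv.refl

variable {G : Type*} [Group G] (e : (L ⊗[K] H) ≃ₐc[L] MonoidAlgebra L G)

/-- The embedding of `G` into the group-like elements of `L ⊗[K] H` given by an isomorphism
`L ⊗[K] H ≅ L[G]`. -/
noncomputable def groupLikeOf : G →* L ⊗[K] H :=
  (e.symm : MonoidAlgebra L G →* L ⊗[K] H).comp (MonoidAlgebra.of L G)

theorem groupLikeOf_injective : Function.Injective (groupLikeOf e) :=
  e.symm.injective.comp MonoidAlgebra.of_injective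

theorem isGroupLikeElem_groupLikeOf (g : G) : IsGroupLikeElem L (groupLikeOf e g) :=
  (MonoidAlgebra.isGroupLikeElem_of (R := L) (A := L) g).map e.symm

variable [FiniteDimensional K L]

/-- The automorphism of `L/K` by which `g : G` acts through `L ⊗[K] H ≅ L[G]`. -/
noncomputable def galOf (g : G) : Gal(L/K) :=
  (algEquivEquivAlgHom K L).symm (S.groupLikeHom (isGroupLikeElem_groupLikeOf e g))

theorem toAlgHom_galOf (g : G) :
    (S.galOf e g : L →ₐ[K] L) = S.groupLikeHom (isGroupLikeElem_groupLikeOf e g) :=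
  (algEquivEquivAlgHom K L).apply_symm_apply _

theorem galOf_apply (g : G) (y : L) : S.galOf e g y = S.orbitMap y (groupLikeOf e g) :=
  DFunLike.congr_fun (S.toAlgHom_galOf e g) y

theorem galOf_injective : Function.Injective (S.galOf e) := fun g h hgh =>
  groupLikeOf_injective e <| S.eq_of_orbitMap_eq fun y => by
    rw [← galOf_apply, ← galOf_apply, hgh]

theorem natCard_eq_finrank (S : HopfGaloisStructure K L H)
    (e : (L ⊗[K] H) ≃ₐc[L] MonoidAlgebra L G) : Nat.card G = Module.finrank K L := by
  have : Finite G := .of_injective _ (S.galOf_injective e)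
  have hH : Module.finrank K H = Nat.card G := by
    rw [← Module.finrank_baseChange (R := L),
      LinearEquiv.finrank_eq (e : (L ⊗[K] H) ≃ₐ[L] MonoidAlgebra L G).toLinearEquiv,
      LinearEquiv.finrank_eq (MonoidAlgebra.coeffLinearEquiv L),
      Module.finrank_eq_nat_card_basis Finsupp.basisSingleOne]
  have : Module.Finite K H := Module.finite_of_finrank_pos (hH ▸ Nat.card_pos)
  have hθ := LinearEquiv.finrank_eq (LinearEquiv.ofBijective _ S.bijective)
  rw [Module.finrank_linearMap, Module.finrank_tensorProduct, hH] at hθ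
  exact (Nat.eq_of_mul_eq_mul_right Module.finrank_pos hθ).symm

theorem galOf_bijective : Function.Bijective (S.galOf e) :=
  (S.galOf_injective e).bijective_of_nat_card_le <| by
    rw [S.natCard_eq_finrank e, Nat.card_eq_fintype_card]
    exact AlgEquiv.card_le

theorem galOf_mul_galOf_apply (g h : G) (y : L) :
    (S.galOf e g * S.galOf e h) y =
      S.orbitMap y (groupLikeOf e g * twist H (S.galOf e g) (groupLikeOf e h)) := by
  rw [AlgEquiv.mul_apply, galOf_apply, galOf_apply,
    S.orbitMap_orbitMap (isGroupLikeElem_groupLikeOf e g), ← toAlgHom_galOf]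
  rfl

theorem exists_groupLikeOf_eq_twist (g h : G) :
    ∃ h', groupLikeOf e h' = twist H (S.galOf e g) (groupLikeOf e h) := by
  obtain ⟨k, hk⟩ := (S.galOf_bijective e).2 (S.galOf e g * S.galOf e h)
  have hgk : groupLikeOf e k = groupLikeOf e g * twist H (S.galOf e g) (groupLikeOf e h) :=
    S.eq_of_orbitMap_eq fun y => by rw [← galOf_apply, hk, galOf_mul_galOf_apply]
  exact ⟨g⁻¹ * k, by rw [map_mul, hgk, ← mul_assoc, ← map_mul, inv_mul_cancel, map_one, one_mul]⟩

theorem isTwistedHom_galOf : IsTwistedHom (S.galOf e) := by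
  intro g
  choose φ hφ using S.exists_groupLikeOf_eq_twist e g
  let Φ : G →* G := .mk' φ fun a b => groupLikeOf_injective e <| by simp only [map_mul, hφ]
  have hΦ : Function.Injective Φ := fun a b hab =>
    groupLikeOf_injective e <| (twist H (S.galOf e g)).injective <| by
      rw [← hφ, ← hφ]
      exact congrArg _ hab
  have : Finite G := .of_injective _ (S.galOf_injective e)
  refine ⟨.ofBijective Φ (Finite.injective_iff_bijective.1 hΦ), fun h => AlgEquiv.ext fun y => ?_⟩
  rw [galOf_mul_galOf_apply, ← hφ, ← map_mul, ← galOf_apply]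
  rfl

end HopfGaloisStructure

theorem theorem1 {K L : Type*} [Field K] [Field L] [Algebra K L]
    [FiniteDimensional K L] [IsGalois K L]
    {H : Type*} [Ring H] [HopfAlgebra K H] (S : HopfGaloisStructure K L H)
    {G : Type*} [Group G] (hS : S.HasType G) (hG : Group.IsNilpotent G) :
    Group.IsSolvable Gal(L/K) := by
  obtain ⟨e⟩ := hS
  have : Finite G := .of_injective _ (S.galOf_injective e)
  exact (S.isTwistedHom_galOf e).isSolvable (S.galOf_bijective e)
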